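/- For a metric space $X$, let $\mathrm{C}^*_u(X)\subset\mathcal B(\ell_2(X))$ denote its uniform Roe algebra, i.e. the norm closure of the $*$-algebra of all operators $a$ of finite propagation (those for which there is $r>0$ with $\langle a\delta_x,\delta_y\rangle=0$ whenever $d(x,y)>r$). It contains the ideal $\mathcal K(\ell_2(X))$ of compact operators. Let $1_X$ be the identity of $\ell_2(X)$, and for $x\in X$ let $e_{xx}$ be the orthogonal projection of $\ell_2(X)$ onto $\mathbb C\delta_x$. A metric space is uniformly locally finite if for each $r>0$ the balls of radius $r$ have uniformly bounded cardinality. An embedding is an injective (not necessarily unital) $*$-homomorphism. A map $\mathrm{C}^*_u(X)\to\mathrm{C}^*_u(Y)$ is strongly continuous if its restriction to every norm-bounded set is continuous with respect to the strong operator topologies (SOT) of $\mathcal B(\ell_2(X))$ and $\mathcal B(\ell_2(Y))$, and it is compact-preserving if it sends compact operators to compact operators. An operator $a\in\mathcal B(\ell_2(Y))$ is quasi-local if for every $\varepsilon>0$ there is $S>0$ such that $\|\chi_Aa\chi_B\|\le\varepsilon$ for all $A,B\subset Y$ with $d(A,B)>S$, where $\chi_A$ is the orthogonal projection onto $\ell_2(A)$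 and $d(A,B)=\inf\{d(x,y): x\in A,\ y\in B\}$ (with $\inf\emptyset=\infty$); the space $Y$ is quasi-local if the norm closure of the set of quasi-local operators on $\ell_2(Y)$ equals $\mathrm{C}^*_u(Y)$. **Statement.** Let $X$ and $Y$ be uniformly locally finite metric spaces and let $\Phi\colon\mathrm{C}^*_u(X)\to\mathrm{C}^*_u(Y)$ be an embedding. Then the sum $p=\mathrm{SOT}\text{-}\sum_{x\in X}\Phi(e_{xx})$ converges in $\mathcal B(\ell_2(Y))$, and the following are equivalent: 1. $\Phi$ is strongly continuous; 2. $p=\Phi(1_X)$. Moreover, if $Y$ is quasi-local or $\Phi$ is compact-preserving, then (1) and (2) are also equivalent to: 3. if $A$ is the hereditary $\mathrm{C}^*$-subalgebra of $\mathrm{C}^*_u(Y)$ generated by $\Phi(\mathrm{C}^*_u(X))$, i.e. the smallest norm-closed $*$-subalgebra of $\mathrm{C}^*_u(Y)$ which contains $\Phi(\mathrm{C}^*_u(X))$ and which contains every $a\in\mathrm{C}^*_u(Y)$ with $0\le a\le b$ for some $b$ in it, then for every $a\in A$, $a\Phi(\mathcal K(\ell_2(X)))=0$ implies $a=0$. 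-/

import Mathlib

open scoped Topology ENNReal

noncomputable section

namespace RoeEmb

/-- The Hilbert space of square-summable complex functions on `X`. -/
abbrev Ell2 (X : Type*) : Type _ := lp (fun _ : X => ℂ) 2

/-- Bounded operators on `ℓ₂(X)`. -/
abbrev Op (X : Type*) : Type _ := Ell2 X →L[ℂ] Ell2 X

/-- A metric space is uniformly locally finite if, for each `r > 0`, the balls of radius `r` have
uniformly bounded cardinality. -/
def UniformlyLocallyFinite (X : Type*) [MetricSpace X] : Prop :=
  ∀ r : ℝ, 0 < r → ∃ N : ℕ, ∀ x : X, (Metric.ball x r).encard ≤ N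

section Basic

variable {X : Type*}

open Classical in
/-- The canonical basis vector `δ_x` of `ℓ₂(X)`. -/
def delta (x : X) : Ell2 X := lp.single 2 x (1 : ℂ)

theorem delta_apply_self (x : X) : delta x x = 1 := by
  classical
  simp [delta]

theorem delta_apply_ne {x y : X} (h : y ≠ x) : delta x y = 0 := by
  classical
  simp [delta, Pi.single_eq_of_ne h]

theorem inner_delta_left (x : X) (f : Ell2 X) : inner ℂ (delta x) f = f x := by
  classical
  have h := lp.inner_single_left (𝕜 := ℂ) (G := fun _ : X => ℂ) x (1 : ℂ) f
  simpa [delta] using h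

/-- The matrix unit `e_xy`: the partial isometry with `e_xy δ_x = δ_y` and `e_xy δ_z = 0` for
`z ≠ x`, that is, `e_xy ξ = ⟨δ_x, ξ⟩ δ_y`. -/
def matrixUnit (x y : X) : Op X := InnerProductSpace.rankOne ℂ (delta y) (delta x)

theorem matrixUnit_apply (x y : X) (f : Ell2 X) : matrixUnit x y f = f x • delta y := by
  simp [matrixUnit, inner_delta_left]

open Classical in
/-- The restriction of `f ∈ ℓ₂(X)` to `A ⊆ X`, extended by zero. -/
def restrict (A : Set X) (f : Ell2 X) : Ell2 X :=
  ⟨fun x => if x ∈ A then f x else 0, by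
    refine (lp.memℓp f).mono' fun x => ?_
    split_ifs <;> simp⟩

theorem restrict_apply_mem {A : Set X} {x : X} (h : x ∈ A) (f : Ell2 X) :
    restrict A f x = f x := by
  simp [restrict, h]

theorem restrict_apply_notMem {A : Set X} {x : X} (h : x ∉ A) (f : Ell2 X) :
    restrict A f x = 0 := by
  simp [restrict, h]

/-- The projection `χ_A` on `ℓ₂(X)`, i.e. the operator of multiplication by the indicator function
of `A`. -/
def chi (A : Set X) : Op X :=
  LinearMap.mkContinuous
    { toFun := restrict A
      map_add' := fun f g => by
        ext x
        by_cases hx : x ∈ A <;> simp [restrict_apply_mem, restrict_apply_notMem, hx]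
      map_smul' := fun c f => by
        ext x
        by_cases hx : x ∈ A <;> simp [restrict_apply_mem, restrict_apply_notMem, hx] }
    1 (fun f => by
      rw [one_mul]
      refine lp.norm_mono (by norm_num) fun x => ?_
      by_cases hx : x ∈ A <;> simp [restrict_apply_mem, restrict_apply_notMem, hx])

end Basic

section Roe

variable {X : Type*} [MetricSpace X]

/-- The propagation of `a` is at most `r`: `d(x,y) > r` implies `⟨a δ_x, δ_y⟩ = 0`. -/
def PropagationLE (a : Op X) (r : ℝ) : Prop :=
  ∀ x y : X, r < dist x y → inner ℂ (a (delta x)) (delta y) = 0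

theorem PropagationLE.iff_apply {a : Op X} {r : ℝ} :
    PropagationLE a r ↔ ∀ x y : X, r < dist x y → a (delta x) y = 0 := by
  unfold PropagationLE
  refine forall₃_congr fun x y _ => ?_
  rw [← inner_delta_left, inner_eq_zero_symm]

theorem PropagationLE.mono {a : Op X} {r s : ℝ} (h : PropagationLE a r) (hrs : r ≤ s) :
    PropagationLE a s :=
  fun x y hxy => h x y (hrs.trans_lt hxy)

theorem PropagationLE.add {a b : Op X} {r : ℝ} (ha : PropagationLE a r) (hb : PropagationLE b r) :
    PropagationLE (a + b) r := fun x y hxy => by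
  simp [ha x y hxy, hb x y hxy]

theorem PropagationLE.star {a : Op X} {r : ℝ} (ha : PropagationLE a r) :
    PropagationLE (star a) r := fun x y hxy => by
  rw [ContinuousLinearMap.star_eq_adjoint, ContinuousLinearMap.adjoint_inner_left,
    inner_eq_zero_symm]
  exact ha y x (by rwa [dist_comm])

theorem PropagationLE.mul {a b : Op X} {r s : ℝ} (ha : PropagationLE a r)
    (hb : PropagationLE b s) : PropagationLE (a * b) (r + s) := fun x y hxy => by
  have ha' := PropagationLE.iff_apply.1 ha.star
  have hb' := PropagationLE.iff_apply.1 hb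
  rw [mul_apply_eq_comp, ← ContinuousLinearMap.adjoint_inner_right,
    ← ContinuousLinearMap.star_eq_adjoint, lp.inner_eq_tsum]
  refine (tsum_congr fun z => ?_).trans tsum_zero
  by_cases hz : s < dist x z
  · rw [hb' x z hz, inner_zero_left]
  · rw [ha' y z, inner_zero_right]
    have h1 := dist_triangle x z y
    rw [dist_comm z y] at h1
    linarith [not_lt.1 hz]

theorem propagationLE_algebraMap (c : ℂ) : PropagationLE (algebraMap ℂ (Op X) c) 0 := by
  rw [PropagationLE.iff_apply]
  intro x y hxy
  have hne : y ≠ x := fun h => by simp [h] at hxy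
  simp [Algebra.algebraMap_eq_smul_one, delta_apply_ne hne]

variable (X) in
/-- The algebraic uniform Roe algebra `C*_u[X]`: the `*`-algebra of all operators on `ℓ₂(X)` with
finite propagation. -/
def algRoe : StarSubalgebra ℂ (Op X) where
  carrier := {a | ∃ r : ℝ, PropagationLE a r}
  mul_mem' := by
    rintro a b ⟨r, ha⟩ ⟨s, hb⟩
    exact ⟨r + s, ha.mul hb⟩
  add_mem' := by
    rintro a b ⟨r, ha⟩ ⟨s, hb⟩
    exact ⟨max r s, (ha.mono (le_max_left _ _)).add (hb.mono (le_max_right _ _))⟩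
  algebraMap_mem' := fun c => ⟨0, propagationLE_algebraMap c⟩
  star_mem' := by
    rintro a ⟨r, ha⟩
    exact ⟨r, ha.star⟩

variable (X) in
/-- The uniform Roe algebra `C*_u(X)`: the norm closure of `C*_u[X]` in `B(ℓ₂(X))`. -/
def roe : StarSubalgebra ℂ (Op X) := (algRoe X).topologicalClosure

theorem matrixUnit_mem_roe (x y : X) : matrixUnit x y ∈ roe X := by
  refine StarSubalgebra.le_topologicalClosure _ ⟨dist x y, ?_⟩
  rw [PropagationLE.iff_apply]
  intro u v huv
  rw [matrixUnit_apply]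
  by_cases hu : x = u
  · subst hu
    have hv : v ≠ y := fun h => by simp [h] at huv
    simp [delta_apply_ne hv]
  · simp [delta_apply_ne hu]

/-- The matrix unit `e_xy` as an element of `C*_u(X)`. -/
def roeUnit (x y : X) : roe X := ⟨matrixUnit x y, matrixUnit_mem_roe x y⟩

/-- The distance `d(A,B) = inf {d(x,y) : x ∈ A, y ∈ B}`, equal to `∞` if `A` or `B` is empty. -/
def setDist (A B : Set X) : ℝ≥0∞ := ⨅ x ∈ A, ⨅ y ∈ B, edist x y

/-- Quasi-local operators: for each `ε > 0` there is `S > 0` such that `d(A,B) > S` implies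
`‖χ_A a χ_B‖ ≤ ε`, for all `A, B ⊆ X`. -/
def IsQuasiLocalOp (a : Op X) : Prop :=
  ∀ ε : ℝ, 0 < ε → ∃ S : ℝ, 0 < S ∧ ∀ A B : Set X,
    ENNReal.ofReal S < setDist A B → ‖chi A * a * chi B‖ ≤ ε

variable (X) in
/-- The space `X` is quasi-local if the quasi-local algebra of `X`, i.e. the norm closure of the
set of quasi-local operators, equals `C*_u(X)`. -/
def QuasiLocalSpace : Prop :=
  closure {a : Op X | IsQuasiLocalOp a} = (roe X : Set (Op X))

variable (X) in
/-- The strong operator topology on `C*_u(X) ⊆ B(ℓ₂(X))`. -/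
@[reducible] def sot : TopologicalSpace (roe X) :=
  TopologicalSpace.induced
    (fun a => ContinuousLinearMap.toPointwiseConvergenceCLM ℂ (RingHom.id ℂ) (Ell2 X) (Ell2 X)
      (a : Op X))
    inferInstance

/-- `p = SOT-∑_i a i`: the net of finite partial sums converges to `p` in the strong operator
topology. -/
def HasSOTSum {ι : Type*} (a : ι → Op X) (p : Op X) : Prop :=
  HasSum
    (fun i => ContinuousLinearMap.toPointwiseConvergenceCLM ℂ (RingHom.id ℂ) (Ell2 X) (Ell2 X)
      (a i))
    (ContinuousLinearMap.toPointwiseConvergenceCLM ℂ (RingHom.id ℂ) (Ell2 X) (Ell2 X) p)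

/-- A hereditary `C*`-subalgebra `B` of `C*_u(X)`: a norm-closed `*`-subalgebra such that
`0 ≤ a ≤ b`, `b ∈ B` and `a ∈ C*_u(X)` imply `a ∈ B` (the order is the usual one on operators). -/
def IsHereditary (B : NonUnitalStarSubalgebra ℂ (roe X)) : Prop :=
  IsClosed (B : Set (roe X)) ∧
    ∀ a b : roe X, b ∈ B → (0 : Op X) ≤ (a : Op X) → (a : Op X) ≤ (b : Op X) → a ∈ B

/-- The hereditary `C*`-subalgebra of `C*_u(X)` generated by the set `S`, i.e. the smallest
hereditary `C*`-subalgebra of `C*_u(X)` containing `S`. -/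
def hereditaryHull (S : Set (roe X)) : NonUnitalStarSubalgebra ℂ (roe X) :=
  sInf {B | IsHereditary B ∧ S ⊆ (B : Set (roe X))}

end Roe

section Maps

variable {X Y : Type*} [MetricSpace X] [MetricSpace Y]

/-- Strong continuity of a map between uniform Roe algebras: on each norm-bounded set it is
continuous from the strong operator topology to the strong operator topology. -/
def StronglyContinuous (Φ : roe X → roe Y) : Prop :=
  ∀ R : ℝ, @ContinuousOn (roe X) (roe Y) (sot X) (sot Y) Φ {a : roe X | ‖a‖ ≤ R}

/-- `Φ` maps compact operators to compact operators. -/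
def CompactPreserving (Φ : roe X → roe Y) : Prop :=
  ∀ a : roe X, IsCompactOperator (a : Op X) → IsCompactOperator (Φ a : Op Y)

/-- With `A` the hereditary subalgebra of `C*_u(Y)` generated by the range of `Φ`:
`a Φ(K(ℓ₂(X))) = 0` implies `a = 0`, for all `a ∈ A`. -/
def CompactsFaithfulOnHull (Φ : roe X → roe Y) : Prop :=
  ∀ a ∈ hereditaryHull (Set.range Φ),
    (∀ k : roe X, IsCompactOperator (k : Op X) → a * Φ k = 0) → a = 0

end Maps

end RoeEmb

end

/-! Write `q = Φ 1`. The projections `Φ(e_xx)` are mutually orthogonal, so their sum `p` converges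
strongly. On the range of `p`, `Φ` is always strongly continuous (`tendsto_map_apply_sum`): if `a i
δ_x → b δ_x`, then `Φ(a i e_xx) → Φ(b e_xx)` even in norm. Hence `p = q` gives strong continuity,
and the converse follows by testing on `χ_F → 1` for finite `F`.

If `p = q`, an element of the hull that kills the `Φ(e_xx)` kills `p = q`, and the hull lies in the
corner of `q`. Conversely `0 ≤ q - p ≤ q`, and `q - p` annihilates `Φ(K)`; so faithfulness forces `q
= p`, provided that `p` lies in `roe Y`.

That membership, `sum_mem_roe`, is the hard point. If it fails, there are disjoint finite sets `F n`
whose images are not approximable, up to a fixed error, within propagations tending to infinity. An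
uncountable almost disjoint family and the countability of `Y` give an infinite union `D` of the `F
n` with `Φ(χ_D) p = Φ(χ_D)`. On subsets of `D` the map `B ↦ Φ(χ_B)` is then strongly continuous, and
Baire category on the Cantor cube yields one propagation bound for all `B ⊆ D` off a finite set.
This contradicts the choice of the `F n`. -/

noncomputable section

namespace RoeEmb

open Filter

/-! ### Bounded nets and positive operators on Hilbert space. -/

section Hilbert

variable {H : Type*} [NormedAddCommGroup H] [InnerProductSpace ℂ H]

/-- For a uniformly bounded family of operators, pointwise convergence at the terms of a convergent
net implies convergence at its limit. -/
theorem tendsto_apply_of_tendsto {ι κ : Type*} {l : Filter ι} {m : Filter κ} [m.NeBot]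
    {T : ι → H →L[ℂ] H} {S : H →L[ℂ] H} {C : ℝ} (hT : ∀ᶠ i in l, ‖T i‖ ≤ C)
    {η : κ → H} {ξ : H} (hη : Tendsto η m (𝓝 ξ))
    (h : ∀ k, Tendsto (fun i => T i (η k)) l (𝓝 (S (η k)))) :
    Tendsto (fun i => T i ξ) l (𝓝 (S ξ)) := by
  rw [Metric.tendsto_nhds]
  intro ε hε
  -- `|C|` and `‖S‖` bound the two error terms on `η k - ξ`; the summand 1 keeps `D` positive.
  set D := |C| + ‖S‖ + 1
  have hD : 0 < D := by positivity
  obtain ⟨k, hk⟩ := (Metric.tendsto_nhds.1 hη (ε / (2 * D)) (by positivity)).exists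
  rw [dist_eq_norm] at hk
  have hk' : D * ‖η k - ξ‖ < ε / 2 := by
    calc D * ‖η k - ξ‖ < D * (ε / (2 * D)) := by gcongr
      _ = ε / 2 := by field_simp
  filter_upwards [hT, Metric.tendsto_nhds.1 (h k) (ε / 2) (by positivity)] with i hi hi'
  rw [dist_eq_norm] at hi' ⊢
  have e : T i ξ - S ξ = (T i (η k) - S (η k)) - T i (η k - ξ) + S (η k - ξ) := by
    simp only [map_sub]; abel
  have h1 : ‖T i (η k - ξ)‖ ≤ |C| * ‖η k - ξ‖ :=
    (T i).le_of_opNorm_le (hi.trans (le_abs_self C)) _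
  have h2 : ‖S (η k - ξ)‖ ≤ ‖S‖ * ‖η k - ξ‖ := S.le_opNorm _
  have h3 := norm_add_le ((T i (η k) - S (η k)) - T i (η k - ξ)) (S (η k - ξ))
  have h4 := norm_sub_le (T i (η k) - S (η k)) (T i (η k - ξ))
  rw [e]
  have h5 : D * ‖η k - ξ‖ = |C| * ‖η k - ξ‖ + ‖S‖ * ‖η k - ξ‖ + ‖η k - ξ‖ := by
    simp only [D]; ring
  have := norm_nonneg (η k - ξ)
  linarith

/-- Bounded sets of operators are relatively compact in the weak operator topology. -/
theorem exists_tendsto_inner_ultrafilter [CompleteSpace H] {ι : Type*} (U : Ultrafilter ι)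
    {T : ι → H →L[ℂ] H} {C : ℝ} (hT : ∀ᶠ i in U, ‖T i‖ ≤ C) :
    ∃ S : H →L[ℂ] H, ∀ ξ η, Tendsto (fun i => inner ℂ (T i ξ) η) U (𝓝 (inner ℂ (S ξ) η)) := by
  have hbd : ∀ ξ η, ∀ᶠ i in U, ‖inner ℂ (T i ξ) η‖ ≤ C * ‖ξ‖ * ‖η‖ := fun ξ η => by
    filter_upwards [hT] with i hi
    exact (norm_inner_le_norm _ _).trans
      (mul_le_mul_of_nonneg_right ((T i).le_of_opNorm_le hi ξ) (norm_nonneg η))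
  -- Closed balls of `ℂ` are compact, so every matrix coefficient converges along `U`; the limits
  -- form a bounded sesquilinear form, which represents `S`.
  have hlim : ∀ ξ η, ∃ z : ℂ, ‖z‖ ≤ C * ‖ξ‖ * ‖η‖ ∧
      Tendsto (fun i => inner ℂ (T i ξ) η) U (𝓝 z) := fun ξ η => by
    obtain ⟨z, hz, hz'⟩ := (isCompact_closedBall (0 : ℂ) (C * ‖ξ‖ * ‖η‖)).ultrafilter_le_nhds
      (U.map fun i => inner ℂ (T i ξ) η) (by
        rw [le_principal_iff]
        exact (hbd ξ η).mono fun i hi => mem_closedBall_zero_iff.2 hi)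
    exact ⟨z, by simpa using hz, hz'⟩
  choose B hB hBt using hlim
  let Bs : H →L⋆[ℂ] H →L[ℂ] ℂ := LinearMap.mkContinuous₂
    (LinearMap.mk₂'ₛₗ (starRingEnd ℂ) (RingHom.id ℂ) B
      (fun a b c => tendsto_nhds_unique (hBt _ _) (by
        simpa only [map_add, inner_add_left] using (hBt a c).add (hBt b c)))
      (fun r a c => tendsto_nhds_unique (hBt _ _) (by
        simpa only [map_smul, inner_smul_left, smul_eq_mul] using
          (hBt a c).const_mul ((starRingEnd ℂ) r)))
      (fun a b c => tendsto_nhds_unique (hBt _ _) (by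
        simpa only [inner_add_right] using (hBt a b).add (hBt a c)))
      (fun r a c => tendsto_nhds_unique (hBt _ _) (by
        simpa only [inner_smul_right, smul_eq_mul, RingHom.id_apply] using
          (hBt a c).const_mul r)))
    C hB
  refine ⟨InnerProductSpace.continuousLinearMapOfBilin Bs, fun ξ η => ?_⟩
  rw [InnerProductSpace.continuousLinearMapOfBilin_apply]
  exact hBt ξ η

/-- A weak operator limit of a net of operators of norm at most `C` has norm at most `C`. -/
theorem opNorm_le_of_tendsto_inner {ι : Type*} {l : Filter ι} [l.NeBot]
    {T : ι → H →L[ℂ] H} {S : H →L[ℂ] H} {C : ℝ} (hC : 0 ≤ C) (hT : ∀ᶠ i in l, ‖T i‖ ≤ C)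
    (h : ∀ ξ η, Tendsto (fun i => inner ℂ (T i ξ) η) l (𝓝 (inner ℂ (S ξ) η))) : ‖S‖ ≤ C := by
  refine S.opNorm_le_bound hC fun ξ => ?_
  have h1 : ‖inner ℂ (S ξ) (S ξ)‖ ≤ C * ‖ξ‖ * ‖S ξ‖ := by
    refine le_of_tendsto (h ξ (S ξ)).norm ?_
    filter_upwards [hT] with i hi
    exact (norm_inner_le_norm _ _).trans
      (mul_le_mul_of_nonneg_right ((T i).le_of_opNorm_le hi ξ) (norm_nonneg _))
  rcases (norm_nonneg (S ξ)).eq_or_lt with h0 | h0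
  · rw [← h0]; positivity
  · rw [inner_self_eq_norm_sq_to_K] at h1
    have h2 : ‖S ξ‖ * ‖S ξ‖ ≤ C * ‖ξ‖ * ‖S ξ‖ := by
      simpa [pow_two] using h1
    exact le_of_mul_le_mul_right h2 h0

/-- If `0 ≤ a ≤ b` then the kernel of `b` is contained in the kernel of `a`. -/
theorem apply_eq_zero_of_nonneg_of_le [CompleteSpace H] {a b : H →L[ℂ] H} (ha : 0 ≤ a)
    (hab : a ≤ b) {ξ : H} (hξ : b ξ = 0) : a ξ = 0 := by
  -- With `a = c* c` and `b ξ = 0`, positivity of `b - a` at `ξ` reads `-‖c ξ‖² ≥ 0`.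
  obtain ⟨c, rfl⟩ := CStarAlgebra.nonneg_iff_eq_star_mul_self.1 ha
  have h1 := ((ContinuousLinearMap.le_def _ _).1 hab).re_inner_nonneg_left ξ
  have h2 : inner ℂ ((star c * c) ξ) ξ = inner ℂ (c ξ) (c ξ) := by
    rw [mul_apply_eq_comp, ContinuousLinearMap.star_eq_adjoint,
      ContinuousLinearMap.adjoint_inner_left]
  rw [sub_apply, hξ, zero_sub, inner_neg_left, h2,
    inner_self_eq_norm_sq_to_K] at h1
  have h3 : ‖c ξ‖ ^ 2 ≤ 0 := by
    simpa [← Complex.ofReal_pow] using h1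
  have h4 : c ξ = 0 := by
    rw [← norm_eq_zero]; exact pow_eq_zero_iff (two_ne_zero) |>.1 (le_antisymm h3 (by positivity))
  rw [mul_apply_eq_comp, h4, map_zero]

end Hilbert

/-! ### Coordinate projections and compact operators. -/

section Chi

variable {X : Type*}

theorem hasSum_smul_delta (f : Ell2 X) : HasSum (fun x => f x • delta x) f := by
  classical
  refine (lp.hasSum_single (by norm_num) f).congr_fun ?_
  intro x
  rw [delta, ← lp.single_smul]
  simp

theorem ext_delta {a b : Op X} (h : ∀ x, a (delta x) = b (delta x)) : a = b := by
  ext1 f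
  refine ((hasSum_smul_delta f).mapL a).unique ?_
  simpa [h] using (hasSum_smul_delta f).mapL b

theorem chi_apply_delta_of_mem {A : Set X} {x : X} (h : x ∈ A) : chi A (delta x) = delta x := by
  ext y
  change restrict A (delta x) y = _
  by_cases hy : y ∈ A
  · rw [restrict_apply_mem hy]
  · rw [restrict_apply_notMem hy, delta_apply_ne (by rintro rfl; exact hy h)]

theorem chi_apply_delta_of_notMem {A : Set X} {x : X} (h : x ∉ A) : chi A (delta x) = 0 := by
  ext y
  change restrict A (delta x) y = _
  by_cases hy : y ∈ A
  · rw [restrict_apply_mem hy, delta_apply_ne (by rintro rfl; exact h hy)]; rfl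
  · rw [restrict_apply_notMem hy]; rfl

theorem chi_mul_chi (A B : Set X) : chi A * chi B = chi (A ∩ B) := by
  refine ext_delta fun x => ?_
  rw [mul_apply_eq_comp]
  by_cases hB : x ∈ B
  · rw [chi_apply_delta_of_mem hB]
    by_cases hA : x ∈ A
    · rw [chi_apply_delta_of_mem hA, chi_apply_delta_of_mem (Set.mem_inter hA hB)]
    · rw [chi_apply_delta_of_notMem hA, chi_apply_delta_of_notMem (A := A ∩ B) fun h => hA h.1]
  · rw [chi_apply_delta_of_notMem hB, chi_apply_delta_of_notMem (A := A ∩ B) fun h => hB h.2, map_zero]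

theorem chi_union {A B : Set X} (h : Disjoint A B) : chi (A ∪ B) = chi A + chi B := by
  refine ext_delta fun x => ?_
  rw [add_apply]
  by_cases hA : x ∈ A
  · rw [chi_apply_delta_of_mem (Set.mem_union_left B hA), chi_apply_delta_of_mem hA,
      chi_apply_delta_of_notMem (h.notMem_of_mem_left hA), add_zero]
  · by_cases hB : x ∈ B
    · rw [chi_apply_delta_of_mem (Set.mem_union_right A hB), chi_apply_delta_of_mem hB,
        chi_apply_delta_of_notMem hA, zero_add]
    · rw [chi_apply_delta_of_notMem hA, chi_apply_delta_of_notMem hB,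
        chi_apply_delta_of_notMem (A := A ∪ B) (fun h => h.elim hA hB), add_zero]

theorem chi_univ : chi (Set.univ : Set X) = 1 :=
  ext_delta fun _ => chi_apply_delta_of_mem (Set.mem_univ _)

theorem chi_empty : chi (∅ : Set X) = 0 :=
  ext_delta fun _ => chi_apply_delta_of_notMem (Set.notMem_empty _)

theorem chi_singleton (x : X) : chi {x} = matrixUnit x x := by
  refine ext_delta fun y => ?_
  rw [matrixUnit_apply]
  by_cases h : y = x
  · subst h
    rw [chi_apply_delta_of_mem (Set.mem_singleton y), delta_apply_self, one_smul]
  · rw [chi_apply_delta_of_notMem (A := {x}) h, delta_apply_ne (Ne.symm h), zero_smul]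

theorem isCompactOperator_matrixUnit (x y : X) : IsCompactOperator (matrixUnit x y) := by
  have h : (matrixUnit x y : Ell2 X → Ell2 X)
      = (ContinuousLinearMap.toSpanSingleton ℂ (delta y)) ∘
        (innerSL ℂ (delta x) : Ell2 X →L[ℂ] ℂ) := by
    ext1 f
    simp [matrixUnit_apply, inner_delta_left]
  rw [h]
  exact IsCompactOperator.continuous_comp
    (isCompactOperator_of_locallyCompactSpace_dom (innerSL ℂ (delta x) : Ell2 X →L[ℂ] ℂ))
    (ContinuousLinearMap.toSpanSingleton ℂ (delta y)).continuous

theorem norm_chi_le (A : Set X) : ‖chi A‖ ≤ 1 :=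
  LinearMap.mkContinuous_norm_le _ zero_le_one _

theorem star_chi (A : Set X) : star (chi A) = chi A := by
  refine ext_delta fun x => ?_
  ext y
  rw [← inner_delta_left, ← inner_delta_left, ContinuousLinearMap.star_eq_adjoint,
    ContinuousLinearMap.adjoint_inner_right]
  by_cases hx : x ∈ A <;> by_cases hy : y ∈ A <;>
    simp only [chi_apply_delta_of_mem, chi_apply_delta_of_notMem, hx, hy, not_false_eq_true,
      inner_zero_left, inner_zero_right, inner_delta_left]
  · rw [delta_apply_ne (by rintro rfl; exact hy hx)]
  · rw [delta_apply_ne (by rintro rfl; exact hx hy)]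

/-- If the indicator functions of the sets `A i` converge pointwise, then the corresponding
projections converge strongly. -/
theorem tendsto_chi_apply_delta {ι : Type*} {l : Filter ι} {A : ι → Set X} {B : Set X}
    (h : ∀ x, ∀ᶠ i in l, (x ∈ A i ↔ x ∈ B)) (x : X) :
    Tendsto (fun i => chi (A i) (delta x)) l (𝓝 (chi B (delta x))) := by
  refine tendsto_nhds_of_eventually_eq ?_
  filter_upwards [h x] with i hi
  by_cases hx : x ∈ B
  · rw [chi_apply_delta_of_mem hx, chi_apply_delta_of_mem (hi.2 hx)]
  · rw [chi_apply_delta_of_notMem hx, chi_apply_delta_of_notMem (mt hi.1 hx)]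

theorem tendsto_apply_of_tendsto_apply_delta {ι : Type*} {l : Filter ι} {a : ι → Op X} {b : Op X}
    {C : ℝ} (ha : ∀ᶠ i in l, ‖a i‖ ≤ C)
    (h : ∀ x, Tendsto (fun i => a i (delta x)) l (𝓝 (b (delta x)))) (ξ : Ell2 X) :
    Tendsto (fun i => a i ξ) l (𝓝 (b ξ)) := by
  refine tendsto_apply_of_tendsto ha (hasSum_smul_delta ξ) fun F => ?_
  simp only [map_sum, map_smul]
  exact tendsto_finsetSum _ fun x _ => (h x).const_smul _

theorem eventually_mem_finset_iff (x : X) :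
    ∀ᶠ F : Finset X in atTop, (x ∈ (F : Set X) ↔ x ∈ (Set.univ : Set X)) := by
  filter_upwards [eventually_ge_atTop {x}] with F hF
  simpa using hF

theorem tendsto_chi_finset_apply (ξ : Ell2 X) :
    Tendsto (fun F : Finset X => chi (F : Set X) ξ) atTop (𝓝 ξ) := by
  have h := tendsto_apply_of_tendsto_apply_delta (l := atTop)
    (a := fun F : Finset X => chi (F : Set X)) (b := chi Set.univ)
    (Eventually.of_forall fun F => norm_chi_le _)
    (tendsto_chi_apply_delta eventually_mem_finset_iff) ξ
  simpa [chi_univ] using h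

/-- Compact operators are norm limits of their finite row truncations. -/
theorem tendsto_chi_finset_mul {k : Op X} (hk : IsCompactOperator k) :
    Tendsto (fun F : Finset X => chi (F : Set X) * k) atTop (𝓝 k) := by
  classical
  rw [Metric.tendsto_nhds]
  intro ε hε
  have hK := (hk.isCompact_closure_image_closedBall (f := (k : Ell2 X →ₗ[ℂ] Ell2 X)) 1)
  -- `χ_F` is almost the identity on a finite net of the image of the unit ball; the three errors
  -- `ε/8 + ε/4 + ε/8` add up to `ε/2`.
  obtain ⟨t, htf, ht⟩ := Metric.totallyBounded_iff.1 hK.totallyBounded (ε / 8) (by positivity)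
  have hev : ∀ᶠ F : Finset X in atTop, ∀ y ∈ t, ‖chi (F : Set X) y - y‖ < ε / 4 := by
    rw [Filter.eventually_all_finite htf]
    intro y _
    simpa [dist_eq_norm] using
      Metric.tendsto_nhds.1 (tendsto_chi_finset_apply y) (ε / 4) (by positivity)
  filter_upwards [hev] with F hF
  rw [dist_eq_norm]
  refine lt_of_le_of_lt (ContinuousLinearMap.opNorm_le_of_unit_norm (by positivity : 0 ≤ ε / 2)
    fun ξ hξ => ?_) (half_lt_self hε)
  obtain ⟨y, hy, hyξ⟩ := Set.mem_iUnion₂.1 (ht (subset_closure ⟨ξ, by simp [hξ], rfl⟩))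
  rw [Metric.mem_ball, dist_eq_norm] at hyξ
  have hyξ' : ‖k ξ - y‖ < ε / 8 := hyξ
  have e : (chi (F : Set X) * k - k) ξ
      = chi (F : Set X) (k ξ - y) + (chi (F : Set X) y - y) - (k ξ - y) := by
    simp only [sub_apply, mul_apply_eq_comp, map_sub]; abel
  rw [e]
  have h1 := norm_sub_le (chi (F : Set X) (k ξ - y) + (chi (F : Set X) y - y)) (k ξ - y)
  have h2 := norm_add_le (chi (F : Set X) (k ξ - y)) (chi (F : Set X) y - y)
  have h3 := (chi (F : Set X)).le_of_opNorm_le (norm_chi_le _) (k ξ - y)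
  have h4 := hF y hy
  linarith

end Chi

/-! ### The strong topology on the uniform Roe algebra. -/

section RoeAlgebra

variable {X : Type*} [MetricSpace X]

theorem isClosed_roe : IsClosed ((roe X : StarSubalgebra ℂ (Op X)) : Set (Op X)) :=
  StarSubalgebra.isClosed_topologicalClosure _

theorem propagationLE_chi (A : Set X) : PropagationLE (chi A) 0 := by
  rw [PropagationLE.iff_apply]
  intro x y hxy
  have hne : y ≠ x := fun h => by simp [h] at hxy
  by_cases hx : x ∈ A
  · rw [chi_apply_delta_of_mem hx, delta_apply_ne hne]
  · rw [chi_apply_delta_of_notMem hx]; rfl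

theorem chi_mem_roe (A : Set X) : chi A ∈ roe X :=
  StarSubalgebra.le_topologicalClosure _ ⟨0, propagationLE_chi A⟩

/-- The projection `χ_A` as an element of `C*_u(X)`. -/
def roeChi (A : Set X) : roe X := ⟨chi A, chi_mem_roe A⟩

theorem tendsto_sot_iff {ι : Type*} {l : Filter ι} {a : ι → roe X} {b : roe X} :
    Tendsto a l (@nhds _ (sot X) b) ↔
      ∀ ξ : Ell2 X, Tendsto (fun i => (a i : Op X) ξ) l (𝓝 ((b : Op X) ξ)) := by
  let _ := sot X
  rw [(Topology.IsInducing.induced _).tendsto_nhds_iff,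
    PointwiseConvergenceCLM.tendsto_iff_forall_tendsto]
  rfl

end RoeAlgebra

/-! ### Image projections and their strong sum. -/

section Embedding

variable {X Y : Type*} [MetricSpace X] [MetricSpace Y] (Φ : roe X →⋆ₙₐ[ℂ] roe Y)

/-- Closedness makes both Roe algebras C*-algebras, between which `*`-homomorphisms are contractive.
-/
theorem norm_map_le (a : roe X) : ‖(Φ a : Op Y)‖ ≤ ‖(a : Op X)‖ := by
  have hX : IsClosed ((roe X : StarSubalgebra ℂ (Op X)) : Set (Op X)) := isClosed_roe
  have hY : IsClosed ((roe Y : StarSubalgebra ℂ (Op Y)) : Set (Op Y)) := isClosed_roe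
  exact NonUnitalStarAlgHom.norm_apply_le Φ a

/-- The projection `Φ(χ_A)` on `ℓ₂(Y)`. -/
def imageProj (A : Set X) : Op Y := (Φ (roeChi A) : Op Y)

theorem imageProj_mem (A : Set X) : imageProj Φ A ∈ roe Y := (Φ (roeChi A)).2

theorem norm_imageProj_le (A : Set X) : ‖imageProj Φ A‖ ≤ 1 :=
  (norm_map_le Φ _).trans (norm_chi_le A)

theorem imageProj_mul (A B : Set X) : imageProj Φ A * imageProj Φ B = imageProj Φ (A ∩ B) := by
  have h : roeChi A * roeChi B = roeChi (A ∩ B) := Subtype.ext (chi_mul_chi A B)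
  rw [imageProj, imageProj, imageProj, ← h, map_mul]
  rfl

theorem imageProj_apply_apply (A B : Set X) (ξ : Ell2 Y) :
    imageProj Φ A (imageProj Φ B ξ) = imageProj Φ (A ∩ B) ξ := by
  rw [← imageProj_mul, mul_apply_eq_comp]

theorem star_imageProj (A : Set X) : star (imageProj Φ A) = imageProj Φ A := by
  have h : star (roeChi A) = roeChi A := Subtype.ext (star_chi A)
  conv_rhs => rw [imageProj, ← h, map_star]
  rfl

theorem imageProj_empty : imageProj Φ (∅ : Set X) = 0 := by
  have h : roeChi (∅ : Set X) = 0 := Subtype.ext chi_empty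
  rw [imageProj, h, map_zero]
  rfl

theorem imageProj_univ : imageProj Φ (Set.univ : Set X) = Φ 1 := by
  have h : roeChi (Set.univ : Set X) = 1 := Subtype.ext chi_univ
  rw [imageProj, h]

theorem imageProj_union {A B : Set X} (hAB : Disjoint A B) :
    imageProj Φ (A ∪ B) = imageProj Φ A + imageProj Φ B := by
  have h : roeChi (A ∪ B) = roeChi A + roeChi B := Subtype.ext (chi_union hAB)
  rw [imageProj, h, map_add]
  rfl

theorem imageProj_singleton (x : X) : imageProj Φ {x} = Φ (roeUnit x x) := by
  have h : roeChi {x} = roeUnit x x := Subtype.ext (chi_singleton x)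
  rw [imageProj, h]

theorem imageProj_inner (A : Set X) (ξ η : Ell2 Y) :
    inner ℂ (imageProj Φ A ξ) η = inner ℂ ξ (imageProj Φ A η) := by
  conv_rhs => rw [← star_imageProj, ContinuousLinearMap.star_eq_adjoint,
    ContinuousLinearMap.adjoint_inner_right]

theorem imageProj_finset (F : Finset X) :
    imageProj Φ (F : Set X) = ∑ x ∈ F, imageProj Φ {x} := by
  classical
  induction F using Finset.induction_on with
  | empty => simp [imageProj_empty]
  | insert x F hx ih =>
    rw [Finset.sum_insert hx, Finset.coe_insert, ← ih, Set.insert_eq, imageProj_union]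
    simpa using hx

theorem norm_imageProj_finset_sq (F : Finset X) (ξ : Ell2 Y) :
    ‖imageProj Φ (F : Set X) ξ‖ ^ 2 = ∑ x ∈ F, ‖imageProj Φ {x} ξ‖ ^ 2 := by
  classical
  induction F using Finset.induction_on with
  | empty => simp [imageProj_empty]
  | insert x F hx ih =>
    have hd : Disjoint ({x} : Set X) F := by simpa using hx
    rw [Finset.sum_insert hx, Finset.coe_insert, ← ih, Set.insert_eq, imageProj_union _ hd,
      add_apply, pow_two, pow_two, pow_two]
    refine norm_add_sq_eq_norm_sq_add_norm_sq_of_inner_eq_zero (𝕜 := ℂ) _ _ ?_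
    rw [imageProj_inner, imageProj_apply_apply, hd.inter_eq, imageProj_empty]
    simp

/-- The summands are orthogonal, so by Pythagoras the Cauchy criterion for the vectors is that for
their squared norms, whose finite sums are at most `‖ξ‖²`. -/
theorem summable_imageProj_apply (ξ : Ell2 Y) : Summable fun x => imageProj Φ {x} ξ := by
  have hs : Summable fun x => ‖imageProj Φ {x} ξ‖ ^ 2 := by
    refine summable_of_sum_le (c := ‖ξ‖ ^ 2) (fun _ => by positivity) fun F => ?_
    rw [← norm_imageProj_finset_sq]
    have := (imageProj Φ (F : Set X)).le_of_opNorm_le (norm_imageProj_le Φ _) ξ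
    rw [one_mul] at this
    gcongr
  rw [summable_iff_vanishing_norm] at hs ⊢
  intro ε hε
  obtain ⟨s, hs⟩ := hs (ε ^ 2) (by positivity)
  refine ⟨s, fun t ht => ?_⟩
  have h := hs t ht
  rw [← norm_imageProj_finset_sq, imageProj_finset, sum_apply, Real.norm_of_nonneg (by positivity)]
    at h
  exact lt_of_pow_lt_pow_left₀ 2 hε.le h

theorem hasSOTSum_iff {p : Op Y} :
    HasSOTSum (fun x : X => (Φ (roeUnit x x) : Op Y)) p ↔
      ∀ ξ, Tendsto (fun F : Finset X => imageProj Φ (F : Set X) ξ) atTop (𝓝 (p ξ)) := by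
  unfold HasSOTSum HasSum
  rw [PointwiseConvergenceCLM.tendsto_iff_forall_tendsto]
  refine forall_congr' fun ξ => ?_
  simp only [SummationFilter.unconditional_filter, imageProj_finset, imageProj_singleton,
    ← map_sum]
  rfl

theorem exists_hasSOTSum : ∃ p : Op Y, HasSOTSum (fun x : X => (Φ (roeUnit x x) : Op Y)) p := by
  have h : ∀ ξ, HasSum (fun x => imageProj Φ {x} ξ) (∑' x, imageProj Φ {x} ξ) :=
    fun ξ => (summable_imageProj_apply Φ ξ).hasSum
  refine ⟨LinearMap.mkContinuous
    { toFun := fun ξ => ∑' x, imageProj Φ {x} ξ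
      map_add' := fun ξ η => by
        refine (h _).unique ?_
        simpa using (h ξ).add (h η)
      map_smul' := fun c ξ => by
        refine (h _).unique ?_
        simpa using (h ξ).const_smul c } 1 fun ξ => ?_, (hasSOTSum_iff Φ).2 fun ξ => ?_⟩
  · refine le_of_tendsto (h ξ).norm (Eventually.of_forall fun F => ?_)
    have := (imageProj Φ (F : Set X)).le_of_opNorm_le (norm_imageProj_le Φ _) ξ
    rwa [imageProj_finset, sum_apply] at this
  · simp only [imageProj_finset, sum_apply]
    exact h ξ

variable {Φ}

theorem tendsto_imageProj_finset {p : Op Y}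
    (hp : HasSOTSum (fun x : X => (Φ (roeUnit x x) : Op Y)) p) (ξ : Ell2 Y) :
    Tendsto (fun F : Finset X => imageProj Φ (F : Set X) ξ) atTop (𝓝 (p ξ)) :=
  (hasSOTSum_iff Φ).1 hp ξ

end Embedding

/-! ### Strong continuity and the identity `p = Φ 1`. -/

section StrongContinuity

variable {X Y : Type*} [MetricSpace X] [MetricSpace Y] {Φ : roe X →⋆ₙₐ[ℂ] roe Y} {p : Op Y}

theorem coe_map_mul_apply (a b : roe X) (ξ : Ell2 Y) :
    (Φ (a * b) : Op Y) ξ = (Φ a : Op Y) ((Φ b : Op Y) ξ) := by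
  rw [map_mul]; rfl

/-- The operator `(a i - b) e_xx` has rank at most one and norm at most `‖(a i - b) δ_x‖`, so strong
convergence becomes norm convergence, which the contraction `Φ` preserves. -/
theorem tendsto_map_mul_singleton {ι : Type*} {l : Filter ι} {a : ι → roe X} {b : roe X} (x : X)
    (h : Tendsto (fun i => (a i : Op X) (delta x)) l (𝓝 ((b : Op X) (delta x)))) :
    Tendsto (fun i => (Φ (a i * roeChi {x}) : Op Y)) l (𝓝 (Φ (b * roeChi {x}) : Op Y)) := by
  rw [tendsto_iff_norm_sub_tendsto_zero] at h ⊢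
  refine squeeze_zero (fun _ => norm_nonneg _) (fun i => ?_) h
  have e : (Φ (a i * roeChi {x}) : Op Y) - (Φ (b * roeChi {x}) : Op Y)
      = (Φ ((a i - b) * roeChi {x}) : Op Y) := by
    rw [sub_mul, map_sub]; rfl
  rw [e]
  refine (norm_map_le Φ _).trans (ContinuousLinearMap.opNorm_le_bound _ (norm_nonneg _) fun ξ => ?_)
  have e2 : (((a i - b) * roeChi {x} : roe X) : Op X) ξ
      = ξ x • ((a i : Op X) (delta x) - (b : Op X) (delta x)) := by
    change ((a i : Op X) - (b : Op X)) (chi {x} ξ) = _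
    rw [chi_singleton, matrixUnit_apply, map_smul, sub_apply]
  rw [e2, norm_smul, mul_comm]
  exact mul_le_mul_of_nonneg_left (lp.norm_apply_le_norm (by norm_num) ξ x) (norm_nonneg _)

/-- On the range of `p`, every embedding of uniform Roe algebras is strongly continuous. -/
theorem tendsto_map_apply_sum (hp : HasSOTSum (fun x : X => (Φ (roeUnit x x) : Op Y)) p)
    {ι : Type*} {l : Filter ι} {a : ι → roe X} {b : roe X} {C : ℝ}
    (ha : ∀ᶠ i in l, ‖(a i : Op X)‖ ≤ C)
    (h : ∀ x, Tendsto (fun i => (a i : Op X) (delta x)) l (𝓝 ((b : Op X) (delta x))))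
    (ξ : Ell2 Y) :
    Tendsto (fun i => (Φ (a i) : Op Y) (p ξ)) l (𝓝 ((Φ b : Op Y) (p ξ))) := by
  refine tendsto_apply_of_tendsto (ha.mono fun i hi => (norm_map_le Φ _).trans hi)
    (tendsto_imageProj_finset hp ξ) fun F => ?_
  simp only [imageProj_finset, sum_apply, map_sum]
  refine tendsto_finsetSum _ fun x _ => ?_
  simp only [imageProj]
  have := ((ContinuousLinearMap.apply ℂ (Ell2 Y) ξ).continuous.tendsto _).comp
    (tendsto_map_mul_singleton (Φ := Φ) x (h x))
  simpa only [Function.comp_def, ContinuousLinearMap.apply_apply, coe_map_mul_apply] using this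

theorem tendsto_imageProj_apply_sum
    (hp : HasSOTSum (fun x : X => (Φ (roeUnit x x) : Op Y)) p)
    {ι : Type*} {l : Filter ι} {A : ι → Set X} {B : Set X}
    (h : ∀ x, ∀ᶠ i in l, (x ∈ A i ↔ x ∈ B)) (ξ : Ell2 Y) :
    Tendsto (fun i => imageProj Φ (A i) (p ξ)) l (𝓝 (imageProj Φ B (p ξ))) :=
  tendsto_map_apply_sum hp (a := fun i => roeChi (A i)) (b := roeChi B) (C := 1)
    (Eventually.of_forall fun i => norm_chi_le (A i)) (tendsto_chi_apply_delta h) ξ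

theorem imageProj_finset_apply_sum (hp : HasSOTSum (fun x : X => (Φ (roeUnit x x) : Op Y)) p)
    {A : Set X} (hA : A.Finite) (ξ : Ell2 Y) : imageProj Φ A (p ξ) = imageProj Φ A ξ := by
  refine tendsto_nhds_unique
    (((imageProj Φ A).continuous.tendsto _).comp (tendsto_imageProj_finset hp ξ)) ?_
  refine tendsto_nhds_of_eventually_eq ?_
  filter_upwards [eventually_ge_atTop hA.toFinset] with F hF
  have hAF : A ⊆ F := fun x hx => hF (hA.mem_toFinset.2 hx)
  rw [Function.comp_apply, imageProj_apply_apply, Set.inter_eq_left.2 hAF]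

theorem map_one_apply_sum (hp : HasSOTSum (fun x : X => (Φ (roeUnit x x) : Op Y)) p)
    (ξ : Ell2 Y) : (Φ 1 : Op Y) (p ξ) = p ξ := by
  rw [← imageProj_univ]
  refine tendsto_nhds_unique (tendsto_imageProj_apply_sum hp eventually_mem_finset_iff ξ) ?_
  simp only [imageProj_finset_apply_sum hp (Finset.finite_toSet _)]
  exact tendsto_imageProj_finset hp ξ

theorem sum_apply_sum (hp : HasSOTSum (fun x : X => (Φ (roeUnit x x) : Op Y)) p)
    (ξ : Ell2 Y) : p (p ξ) = p ξ := by
  refine tendsto_nhds_unique (tendsto_imageProj_finset hp (p ξ)) ?_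
  simp only [imageProj_finset_apply_sum hp (Finset.finite_toSet _)]
  exact tendsto_imageProj_finset hp ξ

theorem sum_apply_imageProj_finset (hp : HasSOTSum (fun x : X => (Φ (roeUnit x x) : Op Y)) p)
    {A : Set X} (hA : A.Finite) (ξ : Ell2 Y) : p (imageProj Φ A ξ) = imageProj Φ A ξ := by
  refine tendsto_nhds_unique (tendsto_imageProj_finset hp _) (tendsto_nhds_of_eventually_eq ?_)
  filter_upwards [eventually_ge_atTop hA.toFinset] with F hF
  have hAF : A ⊆ F := fun x hx => hF (hA.mem_toFinset.2 hx)
  rw [imageProj_apply_apply, Set.inter_eq_right.2 hAF]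

theorem inner_sum_apply (hp : HasSOTSum (fun x : X => (Φ (roeUnit x x) : Op Y)) p)
    (ξ η : Ell2 Y) : inner ℂ (p ξ) η = inner ℂ ξ (p η) := by
  refine tendsto_nhds_unique
    ((tendsto_imageProj_finset hp ξ).inner (𝕜 := ℂ) (tendsto_const_nhds (x := η))) ?_
  simp only [imageProj_inner]
  exact tendsto_const_nhds.inner (tendsto_imageProj_finset hp η)

/-- `Φ k` is the norm limit of `Φ(χ_F) Φ k` over finite `F`, and `p` fixes each `Φ(χ_F)`. -/
theorem sum_mul_map_of_isCompactOperator
    (hp : HasSOTSum (fun x : X => (Φ (roeUnit x x) : Op Y)) p) {k : roe X}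
    (hk : IsCompactOperator (k : Op X)) : p * (Φ k : Op Y) = Φ k := by
  have h1 : Tendsto (fun F : Finset X => imageProj Φ (F : Set X) * (Φ k : Op Y)) atTop
      (𝓝 (Φ k : Op Y)) := by
    have h := tendsto_chi_finset_mul hk
    rw [tendsto_iff_norm_sub_tendsto_zero] at h ⊢
    refine squeeze_zero (fun _ => norm_nonneg _) (fun F => ?_) h
    have e : imageProj Φ (F : Set X) * (Φ k : Op Y) - (Φ k : Op Y)
        = (Φ (roeChi (F : Set X) * k - k) : Op Y) := by
      rw [map_sub, map_mul]; rfl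
    rw [e]
    exact norm_map_le Φ _
  refine tendsto_nhds_unique (h1.const_mul p) ?_
  have h2 : ∀ F : Finset X, p * (imageProj Φ (F : Set X) * (Φ k : Op Y))
      = imageProj Φ (F : Set X) * (Φ k : Op Y) := fun F => by
    ext1 ξ
    simp only [mul_apply_eq_comp, sum_apply_imageProj_finset hp (Finset.finite_toSet _)]
  simpa only [h2] using h1

theorem stronglyContinuous_iff (hp : HasSOTSum (fun x : X => (Φ (roeUnit x x) : Op Y)) p) :
    StronglyContinuous Φ ↔ p = (Φ 1 : Op Y) := by
  constructor
  · intro h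
    ext1 ξ
    let _ := sot X
    let _ := sot Y
    have h1 : Tendsto (fun F : Finset X => roeChi (F : Set X)) atTop
        (@nhds _ (sot X) (1 : roe X)) := by
      rw [tendsto_sot_iff]
      exact tendsto_chi_finset_apply
    have hmem : ∀ A : Set X, roeChi A ∈ {a : roe X | ‖a‖ ≤ 1} := norm_chi_le
    have hone : (1 : roe X) ∈ {a : roe X | ‖a‖ ≤ 1} := by
      have e : roeChi Set.univ = (1 : roe X) := Subtype.ext chi_univ
      exact e ▸ hmem Set.univ
    have h2 := (h 1 1 hone).tendsto.comp
      (tendsto_nhdsWithin_iff.2 ⟨h1, Eventually.of_forall fun F => hmem (F : Set X)⟩)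
    exact tendsto_nhds_unique (tendsto_imageProj_finset hp ξ) (tendsto_sot_iff.1 h2 ξ)
  · rintro rfl R b hb
    refine tendsto_sot_iff.2 fun ξ => ?_
    -- Every vector may be replaced by its image under `Φ 1 = p`, where convergence is already
    -- known.
    have hq : ∀ a : roe X, (Φ a : Op Y) ((Φ 1 : Op Y) ξ) = (Φ a : Op Y) ξ := fun a => by
      rw [← coe_map_mul_apply, mul_one]
    have h1 : Tendsto (fun a : roe X => a) (@nhdsWithin _ (sot X) b {a | ‖a‖ ≤ R})
        (@nhds _ (sot X) b) := tendsto_id.mono_left (@nhdsWithin_le_nhds _ (sot X) _ _)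
    have h2 : ∀ᶠ a : roe X in @nhdsWithin _ (sot X) b {a | ‖a‖ ≤ R}, ‖(a : Op X)‖ ≤ R :=
      @eventually_mem_nhdsWithin _ (sot X) _ _
    simpa only [hq] using
      tendsto_map_apply_sum hp h2 (fun x => tendsto_sot_iff.1 h1 (delta x)) ξ

end StrongContinuity

/-! ### The hereditary hull and faithfulness of the compacts. -/

section Hereditary

variable {X Y : Type*} [MetricSpace X] [MetricSpace Y] {Φ : roe X →⋆ₙₐ[ℂ] roe Y} {p : Op Y}

/-- The corner `q C*_u(Y) q` determined by a projection `q`. -/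
def cornerSubalgebra (q : roe Y) (hq : star q = q) : NonUnitalStarSubalgebra ℂ (roe Y) where
  carrier := {b | b * q = b ∧ q * b = b}
  add_mem' := fun ha hb => ⟨by rw [add_mul, ha.1, hb.1], by rw [mul_add, ha.2, hb.2]⟩
  zero_mem' := ⟨zero_mul q, mul_zero q⟩
  mul_mem' := fun ha hb => ⟨by rw [mul_assoc, hb.1], by rw [← mul_assoc, ha.2]⟩
  smul_mem' := fun c a ha => ⟨by rw [smul_mul_assoc, ha.1], by rw [mul_smul_comm, ha.2]⟩
  star_mem' := fun {a} ha => by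
    refine ⟨?_, ?_⟩
    · conv_lhs => rw [← hq]
      rw [← star_mul, ha.2]
    · conv_lhs => rw [← hq]
      rw [← star_mul, ha.1]

/-- If `0 ≤ a ≤ b` and `b q = b`, then `b`, hence `a`, vanishes on the range of `1 - q`; adjoints
give the other side. -/
theorem isHereditary_cornerSubalgebra (q : roe Y) (hq : star q = q) :
    IsHereditary (cornerSubalgebra q hq) := by
  refine ⟨?_, fun a b hb ha hab => ?_⟩
  · exact (isClosed_eq (continuous_id.mul continuous_const) continuous_id).inter
      (isClosed_eq (continuous_const.mul continuous_id) continuous_id)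
  · have h1 : a * q = a := by
      refine Subtype.ext (ContinuousLinearMap.ext fun ξ => ?_)
      have hz : (b : Op Y) (ξ - (q : Op Y) ξ) = 0 := by
        rw [map_sub, sub_eq_zero]
        exact (congrArg (fun c : roe Y => (c : Op Y) ξ) hb.1).symm
      have := apply_eq_zero_of_nonneg_of_le ha hab hz
      rw [map_sub, sub_eq_zero] at this
      exact this.symm
    have hsa : star a = a := Subtype.ext (IsSelfAdjoint.of_nonneg ha).star_eq
    refine ⟨h1, ?_⟩
    have := congrArg star h1
    rwa [star_mul, hq, hsa] at this

theorem map_one_mul_map_one : (Φ 1) * (Φ 1) = Φ 1 := by rw [← map_mul, one_mul]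

theorem star_map_one : star (Φ 1) = Φ 1 := by rw [← map_star, star_one]

theorem mul_map_one_of_mem_hereditaryHull {a : roe Y}
    (ha : a ∈ hereditaryHull (Set.range Φ)) : a * Φ 1 = a := by
  have hle : hereditaryHull (Set.range Φ) ≤ cornerSubalgebra (Φ 1) star_map_one := by
    refine sInf_le ⟨isHereditary_cornerSubalgebra _ _, ?_⟩
    rintro _ ⟨b, rfl⟩
    exact ⟨by rw [← map_mul, mul_one], by rw [← map_mul, one_mul]⟩
  exact (hle ha).1

theorem compactsFaithfulOnHull_of_eq (hp : HasSOTSum (fun x : X => (Φ (roeUnit x x) : Op Y)) p)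
    (h : p = (Φ 1 : Op Y)) : CompactsFaithfulOnHull Φ := by
  intro a ha hk
  rw [← mul_map_one_of_mem_hereditaryHull ha]
  refine Subtype.ext (ContinuousLinearMap.ext fun ξ => ?_)
  change (a : Op Y) ((Φ 1 : Op Y) ξ) = 0
  rw [← h]
  refine tendsto_nhds_unique
    (((a : Op Y).continuous.tendsto _).comp (tendsto_imageProj_finset hp ξ)) ?_
  refine tendsto_nhds_of_eventually_eq (Eventually.of_forall fun F => ?_)
  simp only [Function.comp_apply, imageProj_finset, sum_apply, map_sum]
  refine Finset.sum_eq_zero fun x _ => ?_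
  rw [imageProj_singleton]
  exact congrArg (fun c : roe Y => (c : Op Y) ξ) (hk _ (isCompactOperator_matrixUnit x x))

/-- The test element is `Φ 1 - p`: it is dominated by `Φ 1`, and both `Φ 1` and `p` act as left
units on `Φ(K)`. Membership of `p` in `roe Y` is what places it in the hull. -/
theorem eq_of_compactsFaithfulOnHull
    (hp : HasSOTSum (fun x : X => (Φ (roeUnit x x) : Op Y)) p) (hmem : p ∈ roe Y)
    (h : CompactsFaithfulOnHull Φ) : p = (Φ 1 : Op Y) := by
  set q : roe Y := Φ 1 with hq
  have hqp : (q : Op Y) * p = p := ContinuousLinearMap.ext fun ξ => map_one_apply_sum hp ξ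
  have hpp : p * p = p := ContinuousLinearMap.ext fun ξ => sum_apply_sum hp ξ
  have hps : star p = p := by
    rw [ContinuousLinearMap.star_eq_adjoint, eq_comm, ContinuousLinearMap.eq_adjoint_iff]
    exact inner_sum_apply hp
  have hqs : star (q : Op Y) = q := congrArg Subtype.val (star_map_one (Φ := Φ))
  have hqq : (q : Op Y) * q = q := congrArg Subtype.val (map_one_mul_map_one (Φ := Φ))
  have hpq : p * (q : Op Y) = p := by
    have := congrArg star hqp
    rwa [star_mul, hps, hqs] at this
  have h0 : (0 : Op Y) ≤ (q : Op Y) - p := by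
    have e : (q : Op Y) - p = star ((q : Op Y) - p) * ((q : Op Y) - p) := by
      rw [star_sub, hps, hqs, sub_mul, mul_sub, mul_sub, hqq, hqp, hpq, hpp, sub_self, sub_zero]
    rw [e]
    exact star_mul_self_nonneg _
  have h1 : (q : Op Y) - p ≤ q := by
    have hp0 : 0 ≤ p := by
      have e : p = star p * p := by rw [hps, hpp]
      rw [e]
      exact star_mul_self_nonneg _
    exact sub_le_self _ hp0
  have hz : q - ⟨p, hmem⟩ = 0 := by
    refine h _ ?_ fun k hk => ?_
    · refine NonUnitalStarAlgebra.mem_sInf.2 fun B hB => ?_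
      exact hB.1.2 _ q (hB.2 ⟨1, rfl⟩) h0 h1
    · have e1 : q * Φ k = Φ k := by rw [hq, ← map_mul, one_mul]
      have e2 : (⟨p, hmem⟩ : roe Y) * Φ k = Φ k :=
        Subtype.ext (sum_mul_map_of_isCompactOperator hp hk)
      rw [sub_mul, e1, e2, sub_self]
  exact (congrArg Subtype.val (sub_eq_zero.1 hz)).symm

end Hereditary

/-! ### Almost disjoint families and countability. -/

section AlmostDisjoint

/-- There is an almost disjoint family of infinite sets of natural numbers indexed by `Set ℕ`. -/
theorem exists_almostDisjoint_family :
    ∃ M : Set ℕ → Set ℕ, (∀ s, (M s).Infinite) ∧ ∀ s t, s ≠ t → (M s ∩ M t).Finite := by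
  classical
  -- `c s n` codes the initial segment of length `n` of `s`, so `M s` is a branch of the binary
  -- tree; branches that differ at `k` share only nodes of length at most `k`.
  let c : Set ℕ → ℕ → ℕ := fun s n =>
    Encodable.encode ((List.range n).map fun k => decide (k ∈ s))
  have hc : ∀ s t m n, c s m = c t n → m = n ∧ ∀ k < m, (k ∈ s ↔ k ∈ t) := by
    intro s t m n h
    have h := Encodable.encode_injective h
    have hmn : m = n := by simpa using congrArg List.length h
    subst hmn
    refine ⟨rfl, fun k hk => ?_⟩
    simpa using List.map_inj_left.1 h k (List.mem_range.2 hk)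
  refine ⟨fun s => Set.range (c s), fun s => Set.infinite_range_of_injective fun m n h =>
    (hc s s m n h).1, fun s t hst => ?_⟩
  obtain ⟨k, hk⟩ : ∃ k, ¬(k ∈ s ↔ k ∈ t) := by
    by_contra! h
    exact hst (Set.ext h)
  refine ((Set.finite_Iic k).image (c s)).subset ?_
  rintro _ ⟨⟨m, rfl⟩, ⟨n, hn⟩⟩
  refine ⟨m, ?_, rfl⟩
  by_contra hm
  exact hk ((hc s t m n hn.symm).2 k (not_le.1 hm))

theorem not_countable_set_nat : ¬Countable (Set ℕ) := fun _ => by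
  obtain ⟨f, hf⟩ := exists_surjective_nat (Set ℕ)
  exact Function.cantor_surjective f hf

/-- A vector is orthogonal to all but countably many members of an orthogonal family. -/
theorem countable_inner_ne_zero {H ι : Type*} [NormedAddCommGroup H] [InnerProductSpace ℂ H]
    {v : ι → H} (hv : ∀ i j, i ≠ j → inner ℂ (v i) (v j) = 0) (w : H) :
    {i | inner ℂ (v i) w ≠ 0}.Countable := by
  set S := {i | inner ℂ (v i) w ≠ 0}
  have hne : ∀ i : S, v i ≠ 0 := fun i h => i.2 (by rw [h, inner_zero_left])
  have ho : Orthonormal ℂ fun i : S => ((‖v i‖⁻¹ : ℝ) : ℂ) • v i := by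
    refine ⟨fun i => ?_, fun i j hij => ?_⟩
    · rw [norm_smul]
      simp [hne i]
    · beta_reduce
      rw [inner_smul_left, inner_smul_right, hv i j (fun h => hij (Subtype.ext h))]
      simp
  -- By Bessel's inequality the squared coefficients are summable, hence only countably many are
  -- nonzero; on `S` none vanishes.
  have hs := (ho.inner_products_summable w).countable_support
  have huniv : Function.support (fun i : S => ‖inner ℂ (((‖v i‖⁻¹ : ℝ) : ℂ) • v i) w‖ ^ 2)
      = Set.univ := by
    refine Set.eq_univ_of_forall fun i => ?_
    rw [Function.mem_support, inner_smul_left]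
    have h2 := hne i
    have h3 : inner ℂ (v i) w ≠ 0 := i.2
    simp [h2, h3]
  rw [huniv, Set.countable_univ_iff] at hs
  exact hs

theorem countable_of_uniformlyLocallyFinite {Y : Type*} [MetricSpace Y]
    (hY : UniformlyLocallyFinite Y) : Countable Y := by
  rcases isEmpty_or_nonempty Y with _ | ⟨⟨y⟩⟩
  · infer_instance
  · rw [← Set.countable_univ_iff, ← Metric.iUnion_ball_nat_succ y]
    refine Set.countable_iUnion fun n => Set.Finite.countable ?_
    obtain ⟨N, hN⟩ := hY (n + 1) (by positivity)
    exact Set.finite_of_encard_le_coe (hN y)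

end AlmostDisjoint

/-! ### Quantitative approximation by finite propagation. -/

section BandApprox

variable {Y : Type*} [MetricSpace Y]

/-- `a` is within `ε` of an operator of propagation at most `r`. -/
def BandApprox (a : Op Y) (r ε : ℝ) : Prop := ∃ b : Op Y, PropagationLE b r ∧ ‖a - b‖ ≤ ε

theorem BandApprox.mono {a : Op Y} {r s ε : ℝ} (h : BandApprox a r ε) (hrs : r ≤ s) :
    BandApprox a s ε := by
  obtain ⟨b, hb, hab⟩ := h
  exact ⟨b, hb.mono hrs, hab⟩

theorem BandApprox.add {a b : Op Y} {r s ε δ : ℝ} (ha : BandApprox a r ε)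
    (hb : BandApprox b s δ) : BandApprox (a + b) (max r s) (ε + δ) := by
  obtain ⟨a', ha', haa⟩ := ha
  obtain ⟨b', hb', hbb⟩ := hb
  refine ⟨a' + b', (ha'.mono (le_max_left _ _)).add (hb'.mono (le_max_right _ _)), ?_⟩
  rw [add_sub_add_comm]
  exact (norm_add_le _ _).trans (add_le_add haa hbb)

theorem BandApprox.neg {a : Op Y} {r ε : ℝ} (ha : BandApprox a r ε) : BandApprox (-a) r ε := by
  obtain ⟨b, hb, hab⟩ := ha
  refine ⟨-b, fun x y hxy => ?_, ?_⟩
  · rw [neg_apply, inner_neg_left, hb x y hxy, neg_zero]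
  · rwa [← neg_add', norm_neg, ← sub_eq_add_neg]

theorem mem_roe_iff_bandApprox {a : Op Y} : a ∈ roe Y ↔ ∀ ε > 0, ∃ r, BandApprox a r ε := by
  change a ∈ closure (algRoe Y : Set (Op Y)) ↔ _
  rw [Metric.mem_closure_iff]
  constructor
  · intro h ε hε
    obtain ⟨b, ⟨r, hb⟩, hab⟩ := h ε hε
    exact ⟨r, b, hb, by rw [← dist_eq_norm]; exact hab.le⟩
  · intro h ε hε
    obtain ⟨r, b, hb, hab⟩ := h (ε / 2) (by positivity)
    refine ⟨b, ⟨r, hb⟩, ?_⟩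
    rw [dist_eq_norm]
    linarith

/-- Uniform approximability by operators of propagation at most `r` passes to bounded strong
limits. -/
theorem BandApprox.of_tendsto {ι : Type*} {l : Filter ι} [l.NeBot] {a : ι → Op Y} {b : Op Y}
    {C r ε : ℝ} (hε : 0 ≤ ε) (ha : ∀ᶠ i in l, ‖a i‖ ≤ C)
    (h : ∀ ξ, Tendsto (fun i => a i ξ) l (𝓝 (b ξ))) (hr : ∀ᶠ i in l, BandApprox (a i) r ε) :
    BandApprox b r ε := by
  classical
  let c : ι → Op Y := fun i => if hi : BandApprox (a i) r ε then hi.choose else 0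
  have hc : ∀ᶠ i in l, PropagationLE (c i) r ∧ ‖a i - c i‖ ≤ ε := by
    filter_upwards [hr] with i hi
    simp only [c, dif_pos hi]
    exact hi.choose_spec
  let U := Ultrafilter.of l
  have hU : (U : Filter ι) ≤ l := Ultrafilter.of_le l
  have hcb : ∀ᶠ i in U, ‖c i‖ ≤ C + ε := by
    filter_upwards [hU hc, hU ha] with i hi hi'
    have := norm_sub_norm_le (c i) (a i)
    rw [norm_sub_rev] at this
    linarith [hi.2]
  -- The approximants need not converge strongly, but a weak limit suffices: vanishing matrix
  -- entries and norm bounds both survive it.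
  obtain ⟨S, hS⟩ := exists_tendsto_inner_ultrafilter U hcb
  refine ⟨S, fun x y hxy => ?_, ?_⟩
  · refine tendsto_nhds_unique (hS (delta x) (delta y)) (tendsto_nhds_of_eventually_eq ?_)
    filter_upwards [hU hc] with i hi
    exact hi.1 x y hxy
  · refine opNorm_le_of_tendsto_inner (l := (U : Filter ι)) (T := fun i => a i - c i) hε
      (Eventually.mono (hU hc) fun i hi => hi.2) fun ξ η => ?_
    simp only [sub_apply, inner_sub_left]
    exact (((h ξ).mono_left hU).inner tendsto_const_nhds).sub (hS ξ η)

end BandApprox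

/-! ### Membership of `p` in the Roe algebra. -/

section SumMem

variable {X Y : Type*} [MetricSpace X] [MetricSpace Y] {Φ : roe X →⋆ₙₐ[ℂ] roe Y} {p : Op Y}

theorem imageProj_apply_sum_of_subset {A B : Set X}
    (hA : ∀ ξ, imageProj Φ A (p ξ) = imageProj Φ A ξ) (hBA : B ⊆ A) (ξ : Ell2 Y) :
    imageProj Φ B (p ξ) = imageProj Φ B ξ := by
  have h := congrArg (imageProj Φ B) (hA ξ)
  rwa [imageProj_apply_apply, imageProj_apply_apply, Set.inter_eq_left.2 hBA] at h

/-- If `Φ(χ_A) p = Φ(χ_A)` then the projections `Φ(χ_B)`, for `B` ranging over the subsets of `A`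
outside some finite set, are uniformly approximable by operators of bounded propagation. -/
theorem exists_finset_bandApprox (hp : HasSOTSum (fun x : X => (Φ (roeUnit x x) : Op Y)) p)
    {A : Set X} (hA : ∀ ξ, imageProj Φ A (p ξ) = imageProj Φ A ξ) {ε : ℝ} (hε : 0 < ε) :
    ∃ (E : Finset X) (r : ℝ), ∀ B ⊆ A, Disjoint B E → BandApprox (imageProj Φ B) r ε := by
  classical
  let S : (X → Bool) → Set X := fun f => {x | x ∈ A ∧ f x = true}
  have hSA : ∀ f, S f ⊆ A := fun f x hx => hx.1
  let C : ℕ → Set (X → Bool) := fun n => {f | BandApprox (imageProj Φ (S f)) n (ε / 2)}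
  have hclosed : ∀ n, IsClosed (C n) := by
    intro n
    refine isClosed_of_closure_subset fun f hf => ?_
    have : (𝓝[C n] f).NeBot := mem_closure_iff_nhdsWithin_neBot.1 hf
    refine BandApprox.of_tendsto (l := 𝓝[C n] f) (a := fun g => imageProj Φ (S g)) (C := 1)
      (by positivity) (Eventually.of_forall fun g => norm_imageProj_le Φ _) (fun ξ => ?_)
      eventually_mem_nhdsWithin
    have h : ∀ x, ∀ᶠ g in 𝓝[C n] f, (x ∈ S g ↔ x ∈ S f) := fun x => by
      have h1 : ∀ᶠ g : X → Bool in 𝓝 f, g x = f x :=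
        (continuous_apply x).continuousAt.eventually (isOpen_discrete {f x} |>.mem_nhds rfl)
      filter_upwards [nhdsWithin_le_nhds h1] with g hg
      simp only [S, Set.mem_ofPred_eq, hg]
    simpa only [imageProj_apply_sum_of_subset hA (hSA _)] using
      tendsto_imageProj_apply_sum hp h ξ
  have hcover : ⋃ n, C n = Set.univ := by
    refine Set.eq_univ_of_forall fun f => ?_
    obtain ⟨r, hr⟩ := mem_roe_iff_bandApprox.1 (imageProj_mem Φ (S f)) (ε / 2) (by positivity)
    obtain ⟨n, hn⟩ := exists_nat_ge r
    exact Set.mem_iUnion.2 ⟨n, hr.mono hn⟩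
  -- Baire category on `X → Bool`; the basic open set found next constrains only the coordinates in
  -- a finite set `E`.
  obtain ⟨n, f, hf⟩ := nonempty_interior_of_iUnion_of_closed hclosed hcover
  obtain ⟨E, u, hu, hsub⟩ := isOpen_pi_iff.1 isOpen_interior f hf
  refine ⟨E, n, fun B hBA hBE => ?_⟩
  have hmem : ∀ g : X → Bool, (∀ x ∈ E, g x = f x) → g ∈ C n := fun g hg =>
    interior_subset (hsub fun x hx => by rw [hg x hx]; exact (hu x hx).2)
  -- Both `g₀` and `g₁` agree with `f` on `E`, and their sets differ exactly by `B`; the two errors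
  -- `ε/2` add up to `ε`.
  let g₀ : X → Bool := fun x => if x ∈ E then f x else false
  let g₁ : X → Bool := fun x => if x ∈ E then f x else decide (x ∈ B)
  have h0 : BandApprox (imageProj Φ (S g₀)) n (ε / 2) :=
    hmem g₀ fun x hx => by simp only [g₀, if_pos hx]
  have h1 : BandApprox (imageProj Φ (S g₁)) n (ε / 2) :=
    hmem g₁ fun x hx => by simp only [g₁, if_pos hx]
  have hBE' : ∀ x ∈ B, x ∉ E := fun x hx hxE => Set.disjoint_left.1 hBE hx hxE
  have hdisj : Disjoint B (S g₀) := by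
    rw [Set.disjoint_left]
    rintro x hx ⟨-, hx'⟩
    simp [g₀, hBE' x hx] at hx'
  have hunion : S g₁ = B ∪ S g₀ := by
    ext x
    by_cases hxE : x ∈ E
    · have : x ∉ B := fun hx => hBE' x hx hxE
      simp [S, g₀, g₁, hxE, this]
    · simp only [S, g₀, g₁, hxE, if_false, Set.mem_ofPred_eq, Set.mem_union, decide_eq_true_eq,
        Bool.false_eq_true, and_false, or_false]
      exact ⟨fun h => h.2, fun h => ⟨hBA h, h⟩⟩
  have e : imageProj Φ B = imageProj Φ (S g₁) + -imageProj Φ (S g₀) := by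
    rw [hunion, imageProj_union _ hdisj, add_neg_cancel_right]
  rw [e]
  simpa using h1.add h0.neg

/-- If `p` cannot be approximated up to `ε` by operators of bounded propagation, then neither can
the projections `Φ(χ_F)`, for `F` finite and disjoint from a given finite set, uniformly. -/
theorem exists_finset_not_bandApprox
    (hp : HasSOTSum (fun x : X => (Φ (roeUnit x x) : Op Y)) p) {ε : ℝ} (hε : 0 < ε)
    (h : ∀ r, ¬BandApprox p r ε) (E : Finset X) (r : ℝ) :
    ∃ F : Finset X, Disjoint (E : Set X) F ∧ ¬BandApprox (imageProj Φ (F : Set X)) r (ε / 2) := by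
  classical
  by_contra! hF
  obtain ⟨s, hs⟩ := mem_roe_iff_bandApprox.1 (imageProj_mem Φ (E : Set X)) (ε / 2) (by positivity)
  refine h (max s r) (BandApprox.of_tendsto (l := atTop)
    (a := fun F : Finset X => imageProj Φ (F : Set X)) (C := 1) hε.le
    (Eventually.of_forall fun F => norm_imageProj_le Φ _) (tendsto_imageProj_finset hp) ?_)
  filter_upwards [eventually_ge_atTop E] with F hEF
  have hd : Disjoint (E : Set X) (F \ E : Finset X) := by
    rw [Finset.disjoint_coe]
    exact Finset.disjoint_sdiff
  have e : (F : Set X) = (E : Set X) ∪ ((F \ E : Finset X) : Set X) := by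
    rw [← Finset.coe_union, Finset.union_sdiff_of_subset hEF]
  rw [e, imageProj_union _ hd]
  simpa using hs.add (hF _ hd)

/-- Given pairwise disjoint finite sets, `Φ(χ_D) p = Φ(χ_D)` for the union `D` of infinitely many of
them. -/
theorem exists_infinite_imageProj_apply_sum [Countable Y]
    (hp : HasSOTSum (fun x : X => (Φ (roeUnit x x) : Op Y)) p) {F : ℕ → Finset X}
    (hF : ∀ m n, m ≠ n → Disjoint (F m : Set X) (F n)) :
    ∃ M : Set ℕ, M.Infinite ∧ ∀ ξ, imageProj Φ (⋃ n ∈ M, (F n : Set X)) (p ξ)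
      = imageProj Φ (⋃ n ∈ M, (F n : Set X)) ξ := by
  obtain ⟨M, hM, hMad⟩ := exists_almostDisjoint_family
  let D : Set ℕ → Set X := fun s => ⋃ n ∈ M s, (F n : Set X)
  have hD : ∀ s t, s ≠ t → (D s ∩ D t).Finite := by
    intro s t hst
    refine ((hMad s t hst).biUnion fun n _ => (F n).finite_toSet).subset ?_
    rintro x ⟨hs, ht⟩
    obtain ⟨m, hm, hxm⟩ := Set.mem_iUnion₂.1 hs
    obtain ⟨n, hn, hxn⟩ := Set.mem_iUnion₂.1 ht
    have hmn : m = n := by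
      by_contra hne
      exact Set.disjoint_left.1 (hF m n hne) hxm hxn
    subst hmn
    exact Set.mem_biUnion (Set.mem_inter hm hn) hxm
  -- For finite `A`, `Φ(χ_A)` kills `(1 - p) δ_y`, so the vectors `Φ(χ_{D s}) w y` are orthogonal
  -- for distinct `s`. Each `y` excludes countably many `s`, and there are countably many `y`.
  let w : Y → Ell2 Y := fun y => delta y - p (delta y)
  have hcount : (⋃ y, {s | inner ℂ (imageProj Φ (D s) (w y)) (w y) ≠ 0}).Countable := by
    refine Set.countable_iUnion fun y => countable_inner_ne_zero (fun s t hst => ?_) (w y)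
    rw [imageProj_inner, imageProj_apply_apply, map_sub,
      imageProj_finset_apply_sum hp (hD s t hst), sub_self, inner_zero_right]
  obtain ⟨s, hs⟩ : ∃ s, s ∉ ⋃ y, {s | inner ℂ (imageProj Φ (D s) (w y)) (w y) ≠ 0} := by
    by_contra! h
    rw [Set.eq_univ_of_forall h, Set.countable_univ_iff] at hcount
    exact not_countable_set_nat hcount
  have hs' : ∀ y, inner ℂ (imageProj Φ (D s) (w y)) (w y) = 0 := by
    simpa using hs
  refine ⟨M s, hM s, fun ξ => ?_⟩
  have hop : imageProj Φ (D s) * p = imageProj Φ (D s) := by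
    refine ext_delta fun y => ?_
    have h := hs' y
    rw [← Set.inter_self (D s), ← imageProj_apply_apply, imageProj_inner,
      inner_self_eq_zero, map_sub, sub_eq_zero] at h
    exact h.symm
  exact congrArg (fun a : Op Y => a ξ) hop

/-- The strong sum `p` of the projections `Φ(e_xx)` belongs to `C*_u(Y)`. -/
theorem sum_mem_roe [Countable Y] (hp : HasSOTSum (fun x : X => (Φ (roeUnit x x) : Op Y)) p) :
    p ∈ roe Y := by
  classical
  rw [mem_roe_iff_bandApprox]
  by_contra! h
  obtain ⟨ε, hε, h⟩ := h
  obtain ⟨f, hf, hfr⟩ := exists_seq_of_forall_finset_exists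
    (fun a : ℕ × Finset X => ¬BandApprox (imageProj Φ (a.2 : Set X)) a.1 (ε / 2))
    (fun a b => a.1 < b.1 ∧ Disjoint (a.2 : Set X) b.2) (fun s _ => by
      obtain ⟨F, hd, hF⟩ := exists_finset_not_bandApprox hp hε h (s.biUnion Prod.snd)
        -- The `+ 1` makes the propagation bounds strictly increasing, so that the `n`-th is at
        -- least `n`.
        ((s.sup Prod.fst + 1 : ℕ) : ℝ)
      refine ⟨(s.sup Prod.fst + 1, F), hF, fun a ha => ⟨?_, ?_⟩⟩
      · exact Nat.lt_succ_of_le (Finset.le_sup (f := Prod.fst) ha)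
      · refine hd.mono_left fun x hx => ?_
        exact Finset.mem_coe.2 (Finset.mem_biUnion.2 ⟨a, ha, hx⟩))
  have hmono : StrictMono fun n => (f n).1 := fun m n hmn => (hfr m n hmn).1
  have hdisj : ∀ m n, m ≠ n → Disjoint ((f m).2 : Set X) (f n).2 := fun m n hmn => by
    rcases lt_or_gt_of_ne hmn with hlt | hlt
    · exact (hfr m n hlt).2
    · exact (hfr n m hlt).2.symm
  obtain ⟨M, hM, hMp⟩ := exists_infinite_imageProj_apply_sum hp hdisj
  obtain ⟨E, r, hE⟩ := exists_finset_bandApprox hp hMp (half_pos hε)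
  -- Each point of the finite set `E` lies in at most one of the disjoint sets, so infinitely many
  -- indices in `M` remain.
  have hfin : {n | ¬Disjoint ((f n).2 : Set X) E}.Finite := by
    have hsub : {n | ¬Disjoint ((f n).2 : Set X) E} ⊆ ⋃ x ∈ E, {n | x ∈ (f n).2} := fun n hn => by
      obtain ⟨x, hx, hxE⟩ := Set.not_disjoint_iff.1 hn
      exact Set.mem_biUnion (Finset.mem_coe.1 hxE) hx
    refine (E.finite_toSet.biUnion fun x _ => Set.Subsingleton.finite ?_).subset hsub
    intro m hm n hn
    by_contra hne
    exact Set.disjoint_left.1 (hdisj m n hne) hm hn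
  obtain ⟨N, hN⟩ := exists_nat_ge r
  obtain ⟨n, hnM, hn⟩ := (hM.sdiff (hfin.union (Set.finite_Iio N))).nonempty
  rw [Set.mem_union, not_or] at hn
  have hnd : Disjoint ((f n).2 : Set X) E := not_not.1 hn.1
  have hnN : N ≤ (f n).1 := (not_lt.1 hn.2).trans (hmono.le_apply)
  refine hf n ((hE _ (Set.subset_biUnion_of_mem (u := fun n => ((f n).2 : Set X)) hnM) hnd).mono ?_)
  exact hN.trans (by exact_mod_cast hnN)

end SumMem

end RoeEmb

end

theorem mainTheorem10 {X Y : Type*} [MetricSpace X] [MetricSpace Y]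
    (hX : RoeEmb.UniformlyLocallyFinite X) (hY : RoeEmb.UniformlyLocallyFinite Y)
    (Φ : RoeEmb.roe X →⋆ₙₐ[ℂ] RoeEmb.roe Y) (hΦ : Function.Injective Φ) :
    ∃ p : RoeEmb.Op Y,
      RoeEmb.HasSOTSum (fun x : X => (Φ (RoeEmb.roeUnit x x) : RoeEmb.Op Y)) p ∧
      (RoeEmb.StronglyContinuous Φ ↔ p = (Φ 1 : RoeEmb.Op Y)) ∧
      ((RoeEmb.QuasiLocalSpace Y ∨ RoeEmb.CompactPreserving Φ) →
        [RoeEmb.StronglyContinuous Φ,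
          p = (Φ 1 : RoeEmb.Op Y),
          RoeEmb.CompactsFaithfulOnHull Φ].TFAE) := by
  obtain ⟨p, hp⟩ := RoeEmb.exists_hasSOTSum Φ
  have := RoeEmb.countable_of_uniformlyLocallyFinite hY
  refine ⟨p, hp, RoeEmb.stronglyContinuous_iff hp, fun _ => ?_⟩
  tfae_have 1 ↔ 2 := RoeEmb.stronglyContinuous_iff hp
  tfae_have 2 → 3 := RoeEmb.compactsFaithfulOnHull_of_eq hp
  tfae_have 3 → 2 := RoeEmb.eq_of_compactsFaithfulOnHull hp (RoeEmb.sum_mem_roe hp)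
  tfae_finish
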